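/- Let $n,m,\ell,k$ be nonnegative integers, $C\in\mathbb{R}^{n\times m}$, $A\in\mathbb{R}^{\ell\times n}$, $B\in\mathbb{R}^{\ell\times m}$, $\gamma>0$, $\lambda\in\mathbb{R}$, and let $\mathcal{K}\subseteq\mathbb{R}^{n\times m}$ be a proper cone (a closed, convex, solid and pointed cone) with dual cone $\mathcal{K}^\star=\{W:\langle W,X\rangle\ge 0\ \forall X\in\mathcal{K}\}$, where $\langle U,V\rangle=\mathrm{tr}(U^\top V)$. Put $$g(X)=\begin{cases}\langle C,X\rangle & \text{if } AX=B,\ X\in\mathcal{K},\\ +\infty&\text{otherwise,}\end{cases}\qquad h(\alpha)=\sup\{\langle B,\Pi\rangle:\ \Pi\in\mathbb{R}^{\ell\times m},\ C-\alpha-A^\top\Pi\in\mathcal{K}^\star\}\quad(\sup\emptyset=-\infty),$$ and let $\mathcal{Y}_n^k=\{P\in\mathbb{R}^{n\times n}: P=P^\top,\ P^2=P,\ \mathrm{tr}(P)\le k\}$. Suppose that for each $Y\in\mathcal{Y}_n^k$ the problem $\min_{X\in\mathbb{R}^{n\times m}}\ g(X)+\frac1{2\gamma}\|X\|_F^2$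 subject to $X=YX$ is either infeasible or satisfies strong duality (its optimal value equals that of its Lagrangian dual). Then strong duality holds between $$\min_{Y\in\mathrm{Conv}(\mathcal{Y}_n^k)}\ \sup_{\alpha\in\mathbb{R}^{n\times m}}\ h(\alpha)-\frac{\gamma}{2}\langle\alpha,Y\alpha\rangle+\lambda\,\mathrm{tr}(Y)$$ and $$\min_{Y\in\mathrm{Conv}(\mathcal{Y}_n^k)}\ \min_{X\in\mathbb{R}^{n\times m},\ \theta\in\mathbb{R}^{m\times m},\ \theta=\theta^\top}\ g(X)+\frac{1}{2\gamma}\mathrm{tr}(\theta)+\lambda\,\mathrm{tr}(Y)\quad\text{subject to}\quad\begin{pmatrix}\theta & X^\top\\ X & Y\end{pmatrix}\succeq 0 .$$ That is, for each $Y\in\mathrm{Conv}(\mathcal{Y}_n^k)$ the inner supremum over $\alpha$ equals the inner minimum over $(X,\theta)$, and hence the two problems have the same optimal value; all the minima are attained (values are taken in $[-\infty,+\infty]$, the value $+\infty$ meaning that the problem is infeasible). -/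

import Mathlib

noncomputable section

namespace MixedProjection

/-- The Euclidean (Frobenius) inner product `⟨X, Z⟩ = tr (Xᵀ Z)` of two matrices. -/
def frob {p q : ℕ} (X Z : Matrix (Fin p) (Fin q) ℝ) : ℝ :=
  (X.transpose * Z).trace

/-- The orthogonal projection matrices `P` of size `n` with `tr P ≤ k`. -/
def projections (n k : ℕ) : Set (Matrix (Fin n) (Fin n) ℝ) :=
  {P | P.IsSymm ∧ P * P = P ∧ P.trace ≤ (k : ℝ)}

/-- The dual cone `K⋆ = {W | ⟨W, X⟩ ≥ 0 for all X ∈ K}`. -/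
def dualCone {n m : ℕ} (K : Set (Matrix (Fin n) (Fin m) ℝ)) :
    Set (Matrix (Fin n) (Fin m) ℝ) :=
  {W | ∀ X ∈ K, 0 ≤ frob W X}

/-- A proper cone: a convex cone (nonempty, closed under addition and under multiplication by
nonnegative scalars) that is closed, solid (it has nonempty interior) and pointed (it contains
no line). -/
structure IsProperCone {n m : ℕ} (K : Set (Matrix (Fin n) (Fin m) ℝ)) : Prop where
  zero_mem : 0 ∈ K
  add_mem : ∀ X ∈ K, ∀ Z ∈ K, X + Z ∈ K
  smul_mem : ∀ t : ℝ, 0 ≤ t → ∀ X ∈ K, t • X ∈ K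
  closed : IsClosed K
  solid : (interior K).Nonempty
  pointed : ∀ X ∈ K, -X ∈ K → X = 0

section

variable {n m l : ℕ} (C : Matrix (Fin n) (Fin m) ℝ) (A : Matrix (Fin l) (Fin n) ℝ)
  (B : Matrix (Fin l) (Fin m) ℝ) (K : Set (Matrix (Fin n) (Fin m) ℝ))

open Classical in
/-- The unregularized cost `g X`: `⟨C, X⟩` if `A X = B` and `X ∈ K`, and `+∞` otherwise. -/
def g (X : Matrix (Fin n) (Fin m) ℝ) : EReal :=
  if A * X = B ∧ X ∈ K then ((frob C X : ℝ) : EReal) else ⊤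

/-- The dual function `h α = sup {⟨B, Q⟩ | C - α - Aᵀ Q ∈ K⋆}` (with value `-∞` if there is no
such `Q`). -/
def h (α : Matrix (Fin n) (Fin m) ℝ) : EReal :=
  ⨆ (Q : Matrix (Fin l) (Fin m) ℝ) (_ : C - α - A.transpose * Q ∈ dualCone K),
    ((frob B Q : ℝ) : EReal)

/-- The Frobenius-regularized subproblem for a given `Y`:
`inf g X + ‖X‖² / (2 γ)` subject to `X = Y X`. -/
def subproblemValue (γ : ℝ) (Y : Matrix (Fin n) (Fin n) ℝ) : EReal :=
  ⨅ (X : Matrix (Fin n) (Fin m) ℝ) (_ : X = Y * X),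
    g C A B K X + ((1 / (2 * γ) * frob X X : ℝ) : EReal)

/-- The Lagrangian of the subproblem, with multipliers `W` for `X = Y X`, `Q` for `A X = B` and
`S ∈ K⋆` for `X ∈ K`. -/
def lagrangian (γ : ℝ) (Y : Matrix (Fin n) (Fin n) ℝ) (X W : Matrix (Fin n) (Fin m) ℝ)
    (Q : Matrix (Fin l) (Fin m) ℝ) (S : Matrix (Fin n) (Fin m) ℝ) : ℝ :=
  frob C X + 1 / (2 * γ) * frob X X + frob W (X - Y * X) + frob Q (B - A * X) - frob S X

/-- The optimal value of the Lagrangian dual of the subproblem. -/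
def subproblemDualValue (γ : ℝ) (Y : Matrix (Fin n) (Fin n) ℝ) : EReal :=
  ⨆ (W : Matrix (Fin n) (Fin m) ℝ) (Q : Matrix (Fin l) (Fin m) ℝ)
    (S : Matrix (Fin n) (Fin m) ℝ) (_ : S ∈ dualCone K),
    ⨅ X : Matrix (Fin n) (Fin m) ℝ, ((lagrangian C A B γ Y X W Q S : ℝ) : EReal)

/-- The standing strong duality assumption: for every projection matrix `Y` with `tr Y ≤ k`, the
subproblem is infeasible or has no duality gap. -/
def StrongDuality (γ : ℝ) (k : ℕ) : Prop :=
  ∀ Y ∈ projections n k,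
    (¬ ∃ X : Matrix (Fin n) (Fin m) ℝ, X = Y * X ∧ A * X = B ∧ X ∈ K) ∨
      subproblemValue C A B K γ Y = subproblemDualValue C A B K γ Y

/-- The inner maximization problem, for a given `Y`:
`sup_α h α - (γ/2) ⟨α, Y α⟩ + lam * tr Y`. -/
def saddleValue (γ lam : ℝ) (Y : Matrix (Fin n) (Fin n) ℝ) : EReal :=
  ⨆ α : Matrix (Fin n) (Fin m) ℝ,
    h C A B K α + ((-(γ / 2 * frob α (Y * α)) + lam * Y.trace : ℝ) : EReal)

/-- The objective `g X + (1/(2γ)) tr θ + lam * tr Y` of the matrix perspective problem. -/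
def perspectiveObjective (γ lam : ℝ) (Y : Matrix (Fin n) (Fin n) ℝ)
    (X : Matrix (Fin n) (Fin m) ℝ) (θ : Matrix (Fin m) (Fin m) ℝ) : EReal :=
  g C A B K X + ((1 / (2 * γ) * θ.trace + lam * Y.trace : ℝ) : EReal)

end

/-- The semidefinite constraint linking `θ`, `X` and `Y`. -/
def PerspectiveFeasible {n m : ℕ} (Y : Matrix (Fin n) (Fin n) ℝ)
    (X : Matrix (Fin n) (Fin m) ℝ) (θ : Matrix (Fin m) (Fin m) ℝ) : Prop :=
  θ.IsSymm ∧ (Matrix.fromBlocks θ X.transpose X Y).PosSemidef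

end MixedProjection

end

/-! Fix `Y` in the hull; it is positive semidefinite, so `Y = R Rᵀ`. The pair `X = R Z`, `θ = Zᵀ Z`
is feasible with `tr θ = ‖Z‖²`, while `⟨α, Y α⟩ = ‖Rᵀ α‖²`. The inner equality thus becomes duality
for minimizing `⟨C, R Z⟩ + ‖Z‖² / (2γ)` over `A R Z = B`, `R Z ∈ K`. Weak duality holds for every
feasible `(X, θ)` because a compression of a semidefinite block matrix has nonnegative trace.

For the converse (`exists_primal_le_of_dual_le`) the constraints are penalized quadratically. Each
penalized minimizer produces a dual feasible point whose value bounds its cost; the term in `‖Z‖²`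
keeps the minimizers bounded, so a limit point is feasible, with cost at most the dual value. No
Slater condition enters, and attainment comes for free.

In `Y`, the supremum over `α` is a supremum of affine functions, hence lower semicontinuous, and it
attains its minimum on the compact hull. -/

/-! ### Conic quadratic duality by penalization. -/

open scoped RealInnerProductSpace in
/-- Optimality conditions for a quadratic penalization of the problem of minimizing
`⟪c, R z⟫ + ‖z‖² / (2 γ)` subject to `A (R z) = b` and `R z ∈ K`. -/
theorem exists_penalized_optimum {E F G : Type*}
    [NormedAddCommGroup E] [InnerProductSpace ℝ E] [FiniteDimensional ℝ E]
    [NormedAddCommGroup F] [InnerProductSpace ℝ F] [FiniteDimensional ℝ F]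
    [NormedAddCommGroup G] [InnerProductSpace ℝ G] [FiniteDimensional ℝ G]
    (R : E →ₗ[ℝ] F) (A : F →ₗ[ℝ] G) (K : Set F) (hK0 : 0 ∈ K)
    (hKadd : ∀ x ∈ K, ∀ y ∈ K, x + y ∈ K) (hKsmul : ∀ t : ℝ, 0 ≤ t → ∀ x ∈ K, t • x ∈ K)
    (hKc : IsClosed K) (c : F) (b : G) (γ : ℝ) (a : ℝ) (ha : 0 < a) :
    ∃ z : E, ∃ w ∈ K,
      (∀ e : E, γ * ⟪c, R e⟫ + ⟪z, e⟫ =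
        a ^ 2 * (⟪b - A (R z), A (R e)⟫ + ⟪w - R z, R e⟫)) ∧
      ⟪w - R z, w⟫ = 0 ∧ ∀ x ∈ K, 0 ≤ ⟪w - R z, x⟫ := by
  -- Completing the square: half the squared distance from `u` to `T (z, w)` is, up to a constant,
  -- `γ⟪c, R z⟫ + ‖z‖²/2 + (a²/2)(‖b - A (R z)‖² + ‖R z - w‖²)`. Minimizing it is projecting `u`
  -- onto the image of `E × K`, which is closed as `T` is injective.
  let T₀ : E × F →ₗ[ℝ] E × (G × F) :=
    (LinearMap.fst ℝ E F).prod ((a • (A ∘ₗ R ∘ₗ LinearMap.fst ℝ E F)).prod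
      (a • (R ∘ₗ LinearMap.fst ℝ E F - LinearMap.snd ℝ E F)))
  let j : E × (G × F) →ₗ[ℝ] WithLp 2 (E × WithLp 2 (G × F)) :=
    { toFun := fun p => WithLp.toLp 2 (p.1, WithLp.toLp 2 p.2)
      map_add' := fun _ _ => rfl
      map_smul' := fun _ _ => rfl }
  let T := j ∘ₗ T₀
  have hTinj : Function.Injective T := by
    refine (injective_iff_map_eq_zero T).2 ?_
    rintro ⟨z, w⟩ h
    have h1 : z = 0 := congrArg (fun p => p.fst) h
    have h2 : a • (R z - w) = 0 := congrArg (fun p => p.snd.snd) h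
    subst h1
    have : w = 0 := by simpa [ha.ne'] using h2
    simp [this]
  let S : Set (WithLp 2 (E × WithLp 2 (G × F))) := T '' (Set.univ ×ˢ K)
  have hSclosed : IsClosed S :=
    (LinearMap.isClosedEmbedding_of_injective (LinearMap.ker_eq_bot.2 hTinj)).isClosedMap _
      (isClosed_univ.prod hKc)
  have hKconv : Convex ℝ K := fun x hx y hy s t hs ht _ =>
    hKadd _ (hKsmul s hs x hx) _ (hKsmul t ht y hy)
  have hSconv : Convex ℝ S := (convex_univ.prod hKconv).linear_image T
  let u : WithLp 2 (E × WithLp 2 (G × F)) :=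
    WithLp.toLp 2 (-(γ • R.adjoint c), WithLp.toLp 2 (a • b, 0))
  obtain ⟨v, hv, hmin⟩ := exists_norm_eq_iInf_of_complete_convex
    (K := S) ⟨T 0, 0, ⟨trivial, hK0⟩, rfl⟩ hSclosed.isComplete hSconv u
  rw [norm_eq_iInf_iff_real_inner_le_zero hSconv hv] at hmin
  obtain ⟨⟨z, w⟩, ⟨-, hw⟩, rfl⟩ := hv
  have key : ∀ (z' : E), ∀ w' ∈ K,
      ⟪-(γ • R.adjoint c) - z, z' - z⟫ + (⟪a • b - a • A (R z), a • A (R z') - a • A (R z)⟫ +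
        ⟪0 - a • (R z - w), a • (R z' - w') - a • (R z - w)⟫) ≤ 0 := fun z' w' hw' => by
    have := hmin (T (z', w')) ⟨(z', w'), ⟨trivial, hw'⟩, rfl⟩
    rw [WithLp.prod_inner_apply, WithLp.prod_inner_apply] at this
    exact this
  have keyw : ∀ w' ∈ K, 0 ≤ ⟪w - R z, w' - w⟫ := fun w' hw' => by
    have h := key z w' hw'
    have e1 : (0 : F) - a • (R z - w) = a • (w - R z) := by module
    have e2 : a • (R z - w') - a • (R z - w) = a • (w - w') := by module
    have e3 : ⟪w - R z, w - w'⟫ = -⟪w - R z, w' - w⟫ := by rw [← inner_neg_right, neg_sub]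
    rw [e1, e2, sub_self, inner_zero_right, sub_self, inner_zero_right, inner_smul_left,
      inner_smul_right, e3] at h
    simp only [conj_trivial] at h
    have : 0 ≤ a * a * ⟪w - R z, w' - w⟫ := by linarith
    exact nonneg_of_mul_nonneg_right this (by positivity)
  -- Testing against `0` and `2w` gives both signs.
  have hw0 : ⟪w - R z, w⟫ = 0 := by
    have h1 := keyw 0 hK0
    have h2 := keyw (w + w) (hKadd _ hw _ hw)
    simp only [zero_sub, inner_neg_right, add_sub_cancel_right] at h1 h2
    linarith
  have keyz : ∀ e : E, 0 ≤ γ * ⟪c, R e⟫ + ⟪z, e⟫ -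
      a ^ 2 * (⟪b - A (R z), A (R e)⟫ + ⟪w - R z, R e⟫) := fun e => by
    have h := key (z + e) w hw
    have e1 : (0 : F) - a • (R z - w) = a • (w - R z) := by module
    have e2 : a • (R (z + e) - w) - a • (R z - w) = a • R e := by rw [map_add]; module
    have e3 : a • A (R (z + e)) - a • A (R z) = a • A (R e) := by rw [map_add, map_add]; module
    rw [e1, e2, e3, ← smul_sub, add_sub_cancel_left, inner_sub_left, inner_neg_left,
      inner_smul_left, inner_smul_left, inner_smul_left, inner_smul_right, inner_smul_right,
      LinearMap.adjoint_inner_left] at h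
    simp only [conj_trivial] at h
    nlinarith [h]
  refine ⟨z, w, hw, fun e => ?_, hw0, fun x hx => ?_⟩
  · have h1 := keyz e
    have h2 := keyz (-e)
    simp only [map_neg, inner_neg_right] at h2
    linarith
  · have := keyw x hx
    rw [inner_sub_right, hw0] at this
    linarith

open scoped RealInnerProductSpace in
/-- A real upper bound `d` for the dual problem is an upper bound for the value of some primal
feasible point. -/
theorem exists_primal_le_of_dual_le {E F G : Type*}
    [NormedAddCommGroup E] [InnerProductSpace ℝ E] [FiniteDimensional ℝ E]
    [NormedAddCommGroup F] [InnerProductSpace ℝ F] [FiniteDimensional ℝ F]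
    [NormedAddCommGroup G] [InnerProductSpace ℝ G] [FiniteDimensional ℝ G]
    (R : E →ₗ[ℝ] F) (A : F →ₗ[ℝ] G) (K : Set F) (hK0 : 0 ∈ K)
    (hKadd : ∀ x ∈ K, ∀ y ∈ K, x + y ∈ K) (hKsmul : ∀ t : ℝ, 0 ≤ t → ∀ x ∈ K, t • x ∈ K)
    (hKc : IsClosed K) (c : F) (b : G) (γ : ℝ) (hγ : 0 < γ) (d : ℝ)
    (hd : ∀ α q, (∀ x ∈ K, 0 ≤ ⟪c - α - A.adjoint q, x⟫) →
      ⟪b, q⟫ - γ / 2 * ‖R.adjoint α‖ ^ 2 ≤ d) :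
    ∃ z : E, A (R z) = b ∧ R z ∈ K ∧ ⟪c, R z⟫ + 1 / (2 * γ) * ‖z‖ ^ 2 ≤ d := by
  have step : ∀ a : ℝ, 0 < a → ∃ z : E, ∃ w ∈ K, ⟪c, R z⟫ + 1 / (2 * γ) * ‖z‖ ^ 2 +
      a ^ 2 / γ * (‖b - A (R z)‖ ^ 2 + ‖w - R z‖ ^ 2) ≤ d := fun a ha => by
    obtain ⟨z, w, hw, hz, hw0, hs⟩ :=
      exists_penalized_optimum R A K hK0 hKadd hKsmul hKc c b γ a ha
    refine ⟨z, w, hw, ?_⟩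
    -- The scaled residuals serve as multipliers for `A (R z) = b` and `R z ∈ K`; with `α = c - s -
    -- A.adjoint q`, stationarity reads `R.adjoint α = -z / γ`.
    set q := (a ^ 2 / γ) • (b - A (R z)) with hq
    set s := (a ^ 2 / γ) • (w - R z) with hsdef
    have hadj : R.adjoint (c - s - A.adjoint q) = -(1 / γ) • z := by
      refine ext_inner_right ℝ fun e => ?_
      rw [LinearMap.adjoint_inner_left, inner_sub_left, inner_sub_left,
        LinearMap.adjoint_inner_left, hq, hsdef, inner_smul_left, inner_smul_left, inner_smul_left]
      simp only [conj_trivial]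
      have := hz e
      field_simp
      linarith
    have h := hd (c - s - A.adjoint q) q (fun x hx => by
      have : c - (c - s - A.adjoint q) - A.adjoint q = s := by abel
      rw [this, hsdef, inner_smul_left]
      exact mul_nonneg (by simp; positivity) (hs x hx))
    rw [hadj, norm_smul, hq, inner_smul_right] at h
    have hzz := hz z
    have e1 : ⟪b - A (R z), A (R z)⟫ = ⟪b, b - A (R z)⟫ - ‖b - A (R z)‖ ^ 2 := by
      rw [← real_inner_self_eq_norm_sq, inner_sub_right (b - A (R z)), real_inner_comm b]
      ring
    have e2 : ⟪w - R z, R z⟫ = - ‖w - R z‖ ^ 2 := by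
      rw [← real_inner_self_eq_norm_sq, inner_sub_right (w - R z), hw0]
      ring
    rw [e1, e2, real_inner_self_eq_norm_sq] at hzz
    have e3 : (‖-(1 / γ)‖ * ‖z‖) ^ 2 = ‖z‖ ^ 2 / γ ^ 2 := by
      rw [mul_pow, Real.norm_eq_abs, sq_abs]; field_simp
    rw [e3] at h
    refine le_trans (le_of_eq ?_) h
    have : a ^ 2 * ⟪b, b - A (R z)⟫ = γ * ⟪c, R z⟫ + ‖z‖ ^ 2 +
      a ^ 2 * (‖b - A (R z)‖ ^ 2 + ‖w - R z‖ ^ 2) := by linarith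
    rw [div_mul_eq_mul_div (a ^ 2) γ ⟪b, b - A (R z)⟫, this]
    field_simp
    ring
  choose z w hwK hzw using fun i : ℕ => step ((i : ℝ) + 1) (by positivity)
  have hcz : ∀ i, -(‖R.adjoint c‖ * ‖z i‖) ≤ ⟪c, R (z i)⟫ := fun i => by
    rw [← LinearMap.adjoint_inner_left]
    exact neg_le_of_abs_le (abs_real_inner_le_norm _ _)
  have hpen : ∀ i : ℕ, 0 ≤ ((i : ℝ) + 1) ^ 2 / γ *
      (‖b - A (R (z i))‖ ^ 2 + ‖w i - R (z i)‖ ^ 2) := fun i => by positivity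
  obtain ⟨M, hM⟩ : ∃ M : ℝ, ∀ i, ‖z i‖ ≤ M := by
    -- The summand `1` forces `‖z i‖ ≥ 1` in the contrary case, so `d ≤ |d| ‖z i‖` and a factor `‖z
    -- i‖` cancels.
    refine ⟨2 * γ * (‖R.adjoint c‖ + |d|) + 1, fun i => ?_⟩
    by_contra! hlt
    have h1 : 1 / (2 * γ) * ‖z i‖ ^ 2 ≤ d + ‖R.adjoint c‖ * ‖z i‖ := by
      linarith [hzw i, hcz i, hpen i]
    have h2 : ‖z i‖ ^ 2 ≤ 2 * γ * (d + ‖R.adjoint c‖ * ‖z i‖) := by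
      have := mul_le_mul_of_nonneg_left h1 (show 0 ≤ 2 * γ by positivity)
      rwa [← mul_assoc, mul_one_div_cancel (by positivity), one_mul] at this
    have h3 : 1 ≤ ‖z i‖ := by
      have : 0 ≤ 2 * γ * (‖R.adjoint c‖ + |d|) := by positivity
      linarith
    have h4 : d ≤ |d| * ‖z i‖ := (le_abs_self d).trans (le_mul_of_one_le_right (abs_nonneg _) h3)
    have h5 : ‖z i‖ * ‖z i‖ ≤ 2 * γ * (‖R.adjoint c‖ + |d|) * ‖z i‖ := by
      have := mul_le_mul_of_nonneg_left h4 (show 0 ≤ 2 * γ by positivity)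
      nlinarith
    have := le_of_mul_le_mul_right h5 (by linarith)
    linarith
  obtain ⟨z₀, -, φ, hφ, hlim⟩ := tendsto_subseq_of_bounded
    (Metric.isBounded_closedBall (x := (0 : E)) (r := M)) (x := z) (fun i => by simpa using hM i)
  have hRc : Continuous R := R.continuous_of_finiteDimensional
  have hAc : Continuous A := A.continuous_of_finiteDimensional
  set N : ℝ := γ * (d + ‖R.adjoint c‖ * M) with hN
  have hsmall : ∀ i, ‖b - A (R (z i))‖ ^ 2 + ‖w i - R (z i)‖ ^ 2 ≤ N * (1 / ((i : ℝ) + 1)) := by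
    intro i
    have h1 : ((i : ℝ) + 1) ^ 2 / γ * (‖b - A (R (z i))‖ ^ 2 + ‖w i - R (z i)‖ ^ 2) ≤
        d + ‖R.adjoint c‖ * M := by
      have h2 := mul_le_mul_of_nonneg_left (hM i) (norm_nonneg (R.adjoint c))
      have h3 : 0 ≤ 1 / (2 * γ) * ‖z i‖ ^ 2 := by positivity
      linarith [hzw i, hcz i]
    set D := ‖b - A (R (z i))‖ ^ 2 + ‖w i - R (z i)‖ ^ 2 with hD
    have hD0 : 0 ≤ D := by positivity
    have hi : (0 : ℝ) ≤ i := i.cast_nonneg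
    have h2 : ((i : ℝ) + 1) ^ 2 * D ≤ N := by
      have := mul_le_mul_of_nonneg_left h1 hγ.le
      rwa [← mul_assoc, mul_div_cancel₀ _ hγ.ne'] at this
    rw [mul_one_div, le_div_iff₀ (by positivity)]
    nlinarith [mul_nonneg hD0 hi, mul_nonneg (mul_nonneg hD0 hi) hi]
  have hsum0 : Filter.Tendsto (fun i => ‖b - A (R (z i))‖ ^ 2 + ‖w i - R (z i)‖ ^ 2)
      Filter.atTop (nhds 0) :=
    squeeze_zero (fun i => by positivity) hsmall
      (by simpa using tendsto_one_div_add_atTop_nhds_zero_nat.const_mul N)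
  have hb0 : Filter.Tendsto (fun i => b - A (R (z i))) Filter.atTop (nhds 0) :=
    tendsto_zero_iff_norm_tendsto_zero.2 <| by
      simpa [Real.sqrt_sq] using (squeeze_zero (fun i => by positivity)
        (fun i => le_add_of_nonneg_right (by positivity)) hsum0).sqrt
  have hw0 : Filter.Tendsto (fun i => w i - R (z i)) Filter.atTop (nhds 0) :=
    tendsto_zero_iff_norm_tendsto_zero.2 <| by
      simpa [Real.sqrt_sq] using (squeeze_zero (fun i => by positivity)
        (fun i => le_add_of_nonneg_left (by positivity)) hsum0).sqrt
  have hRlim : Filter.Tendsto (fun i => R (z (φ i))) Filter.atTop (nhds (R z₀)) :=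
    (hRc.tendsto z₀).comp hlim
  refine ⟨z₀, ?_, ?_, ?_⟩
  · have h1 : Filter.Tendsto (fun i => b - A (R (z (φ i)))) Filter.atTop
        (nhds (b - A (R z₀))) := ((hAc.tendsto _).comp hRlim).const_sub b
    have h2 := tendsto_nhds_unique h1 (hb0.comp hφ.tendsto_atTop)
    exact (sub_eq_zero.1 h2).symm
  · refine hKc.mem_of_tendsto (f := fun i => w (φ i)) (b := Filter.atTop) ?_
      (Filter.Eventually.of_forall fun i => hwK _)
    simpa using (hw0.comp hφ.tendsto_atTop).add hRlim
  · refine le_of_tendsto (f := fun i => ⟪c, R (z (φ i))⟫ + 1 / (2 * γ) * ‖z (φ i)‖ ^ 2)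
      (x := Filter.atTop)
      ((tendsto_const_nhds.inner hRlim).add ((hlim.norm.pow 2).const_mul _))
      (Filter.Eventually.of_forall fun i => ?_)
    linarith [hzw (φ i), hpen (φ i)]

/-! ### Compactness of convex hulls, by Carathéodory. -/

/-- In a finite-dimensional space the convex hull of a compact set is compact. -/
theorem IsCompact.convexHull_of_finiteDimensional {E : Type*} [AddCommGroup E] [Module ℝ E]
    [TopologicalSpace E] [ContinuousAdd E] [ContinuousSMul ℝ E] [FiniteDimensional ℝ E]
    {s : Set E} (hs : IsCompact s) : IsCompact (convexHull ℝ s) := by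
  have step : ∀ j : ℕ, ∃ D : Set E, IsCompact D ∧ D ⊆ convexHull ℝ s ∧
      ∀ t : Finset E, (t : Set E) ⊆ s → t.card ≤ j → convexHull ℝ (t : Set E) ⊆ D := by
    intro j
    induction j with
    | zero =>
      refine ⟨∅, isCompact_empty, Set.empty_subset _, fun t _ ht => ?_⟩
      rw [Finset.card_eq_zero.1 (Nat.le_zero.1 ht)]
      simp
    | succ j ih =>
      obtain ⟨D, hD, hDs, hDt⟩ := ih
      let f : ℝ × (E × E) → E := fun p => (1 - p.1) • p.2.1 + p.1 • p.2.2
      have hf : Continuous f := by fun_prop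
      -- A hull of `j + 1` points consists of segments from one of them to the hull of the others,
      -- which lies in `D`; the piece `s` covers singletons.
      refine ⟨s ∪ f '' (Set.Icc 0 1 ×ˢ (s ×ˢ D)),
        hs.union ((isCompact_Icc.prod (hs.prod hD)).image hf), ?_, ?_⟩
      · refine Set.union_subset (subset_convexHull ℝ s) ?_
        rintro _ ⟨⟨r, x, y⟩, ⟨⟨h0, h1⟩, hx, hy⟩, rfl⟩
        exact convex_convexHull ℝ s (subset_convexHull ℝ s hx) (hDs hy) (sub_nonneg.2 h1) h0
          (sub_add_cancel _ _)
      · classical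
        intro t hts htc x hx
        rcases t.eq_empty_or_nonempty with rfl | ⟨y, hy⟩
        · simp at hx
        rcases (t.erase y).eq_empty_or_nonempty with he | hne
        · have : t = {y} := by rw [← Finset.insert_erase hy, he]; rfl
          rw [this, Finset.coe_singleton, convexHull_singleton] at hx
          exact Or.inl (hx ▸ hts hy)
        · rw [← Finset.insert_erase hy, Finset.coe_insert,
            convexHull_insert (Finset.coe_nonempty.2 hne), convexJoin_singleton_left] at hx
          obtain ⟨z, hz, hxz⟩ := Set.mem_iUnion₂.1 hx
          rw [segment_eq_image] at hxz
          obtain ⟨r, hr, rfl⟩ := hxz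
          refine Or.inr ⟨(r, y, z), ⟨hr, hts hy, hDt (t.erase y) ?_ ?_ hz⟩, rfl⟩
          · exact (Finset.coe_subset.2 (Finset.erase_subset _ _)).trans hts
          · rw [Finset.card_erase_of_mem hy]; omega
  obtain ⟨D, hD, hDs, hDt⟩ := step (Module.finrank ℝ E + 1)
  convert hD
  refine Set.Subset.antisymm (fun x hx => ?_) hDs
  rw [convexHull_eq_union] at hx
  simp only [Set.mem_iUnion] at hx
  obtain ⟨t, hts, hind, hxt⟩ := hx
  refine hDt t hts ?_ hxt
  have h1 := hind.card_le_finrank_succ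
  rw [Fintype.card_coe] at h1
  exact h1.trans (Nat.succ_le_succ (Submodule.finrank_le _))

/-! ### Matrices as a Euclidean space. -/

namespace MixedProjection

section frob

variable {p q r : ℕ}

theorem frob_comm (X Z : Matrix (Fin p) (Fin q) ℝ) : frob X Z = frob Z X := by
  rw [frob, ← Matrix.trace_transpose, Matrix.transpose_mul, Matrix.transpose_transpose, frob]

theorem frob_sub_left (X Z W : Matrix (Fin p) (Fin q) ℝ) :
    frob (X - Z) W = frob X W - frob Z W := by
  simp [frob, Matrix.sub_mul]

theorem frob_mul_left (M : Matrix (Fin p) (Fin q) ℝ) (X : Matrix (Fin q) (Fin r) ℝ)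
    (Z : Matrix (Fin p) (Fin r) ℝ) : frob (M * X) Z = frob X (M.transpose * Z) := by
  simp [frob, Matrix.transpose_mul, Matrix.mul_assoc]

theorem frob_eq_sum (X Z : Matrix (Fin p) (Fin q) ℝ) :
    frob X Z = ∑ j, ∑ i, X i j * Z i j := by
  simp [frob, Matrix.trace, Matrix.mul_apply]

/-- Matrices with the Frobenius inner product, as a Euclidean space. -/
def vec (p q : ℕ) : Matrix (Fin p) (Fin q) ℝ ≃ₗ[ℝ] EuclideanSpace ℝ (Fin p × Fin q) where
  toFun X := WithLp.toLp 2 fun ij => X ij.1 ij.2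
  invFun v := Matrix.of fun i j => v (i, j)
  map_add' _ _ := rfl
  map_smul' _ _ := rfl
  left_inv _ := rfl
  right_inv _ := rfl

theorem inner_vec (X Z : Matrix (Fin p) (Fin q) ℝ) :
    inner ℝ (vec p q X) (vec p q Z) = frob X Z := by
  rw [frob_eq_sum, PiLp.inner_apply, Fintype.sum_prod_type_right]
  exact Finset.sum_congr rfl fun j _ => Finset.sum_congr rfl fun i _ => mul_comm (Z i j) (X i j)

theorem norm_vec_sq (X : Matrix (Fin p) (Fin q) ℝ) : ‖vec p q X‖ ^ 2 = frob X X := by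
  rw [← real_inner_self_eq_norm_sq, inner_vec]

/-- Left multiplication by a matrix, on vectorized matrices. -/
def vecMulLeft (r : ℕ) (M : Matrix (Fin p) (Fin q) ℝ) :
    EuclideanSpace ℝ (Fin q × Fin r) →ₗ[ℝ] EuclideanSpace ℝ (Fin p × Fin r) where
  toFun v := vec p r (M * (vec q r).symm v)
  map_add' v w := by rw [map_add, Matrix.mul_add, map_add]
  map_smul' t v := by rw [map_smul, Matrix.mul_smul, map_smul, RingHom.id_apply]

theorem vecMulLeft_vec (M : Matrix (Fin p) (Fin q) ℝ) (X : Matrix (Fin q) (Fin r) ℝ) :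
    vecMulLeft r M (vec q r X) = vec p r (M * X) := by
  simp [vecMulLeft]

theorem adjoint_vecMulLeft (M : Matrix (Fin p) (Fin q) ℝ) :
    (vecMulLeft r M).adjoint = vecMulLeft r M.transpose := by
  symm
  rw [LinearMap.eq_adjoint_iff]
  intro x y
  obtain ⟨X, rfl⟩ := (vec p r).surjective x
  obtain ⟨Z, rfl⟩ := (vec q r).surjective y
  rw [vecMulLeft_vec, vecMulLeft_vec, inner_vec, inner_vec, frob_mul_left,
    Matrix.transpose_transpose]

end frob

/-! ### Duality between the saddle and perspective problems for fixed `Y`. -/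

section duality

variable {n m l : ℕ} {C : Matrix (Fin n) (Fin m) ℝ} {A : Matrix (Fin l) (Fin n) ℝ}
  {B : Matrix (Fin l) (Fin m) ℝ} {K : Set (Matrix (Fin n) (Fin m) ℝ)}

theorem exists_factor_le_of_dual_le (hK : IsProperCone K) {γ : ℝ} (hγ : 0 < γ)
    (R : Matrix (Fin n) (Fin n) ℝ) (d : ℝ)
    (hd : ∀ α Q, C - α - A.transpose * Q ∈ dualCone K →
      frob B Q - γ / 2 * frob α (R * R.transpose * α) ≤ d) :
    ∃ Z : Matrix (Fin n) (Fin m) ℝ, A * (R * Z) = B ∧ R * Z ∈ K ∧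
      frob C (R * Z) + 1 / (2 * γ) * frob Z Z ≤ d := by
  have hcont : Continuous (vec n m).symm :=
    (vec n m).symm.toLinearMap.continuous_of_finiteDimensional
  obtain ⟨z, h1, h2, h3⟩ := exists_primal_le_of_dual_le (vecMulLeft m R) (vecMulLeft m A)
    ((vec n m).symm ⁻¹' K) (by simpa using hK.zero_mem)
    (fun x hx y hy => by simpa using hK.add_mem _ hx _ hy)
    (fun t ht x hx => by simpa using hK.smul_mem t ht _ hx)
    (hK.closed.preimage hcont) (vec n m C) (vec l m B) γ hγ d (fun α q h => by
      obtain ⟨α, rfl⟩ := (vec n m).surjective α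
      obtain ⟨Q, rfl⟩ := (vec l m).surjective q
      rw [adjoint_vecMulLeft, vecMulLeft_vec, inner_vec, norm_vec_sq, frob_mul_left,
        Matrix.transpose_transpose, ← Matrix.mul_assoc]
      refine hd α Q fun X hX => ?_
      have := h (vec n m X) (by simpa using hX)
      rwa [adjoint_vecMulLeft, vecMulLeft_vec, ← map_sub, ← map_sub, inner_vec] at this)
  obtain ⟨Z, rfl⟩ := (vec n m).surjective z
  rw [vecMulLeft_vec] at h1 h2 h3
  rw [vecMulLeft_vec] at h1
  rw [inner_vec, norm_vec_sq] at h3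
  exact ⟨Z, (vec l m).injective h1, by simpa using h2, h3⟩

/-- The right-hand side is the trace of the block matrix compressed by the column `(1; α)`. -/
theorem PerspectiveFeasible.trace_nonneg {Y : Matrix (Fin n) (Fin n) ℝ}
    {X : Matrix (Fin n) (Fin m) ℝ} {θ : Matrix (Fin m) (Fin m) ℝ}
    (hf : PerspectiveFeasible Y X θ) (α : Matrix (Fin n) (Fin m) ℝ) :
    0 ≤ θ.trace + 2 * frob α X + frob α (Y * α) := by
  have h := (hf.2.conjTranspose_mul_mul_same
    (Matrix.fromRows (1 : Matrix (Fin m) (Fin m) ℝ) α)).trace_nonneg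
  rw [Matrix.conjTranspose_eq_transpose_of_trivial, Matrix.transpose_fromRows,
    Matrix.fromCols_mul_fromBlocks, Matrix.fromCols_mul_fromRows] at h
  simp only [Matrix.transpose_one, Matrix.one_mul, Matrix.mul_one, Matrix.add_mul,
    Matrix.trace_add, Matrix.mul_assoc] at h
  have h1 : (X.transpose * α).trace = frob α X := frob_comm X α
  have h2 : (α.transpose * X).trace = frob α X := rfl
  have h3 : (α.transpose * (Y * α)).trace = frob α (Y * α) := rfl
  linarith

theorem dual_le_primal {γ : ℝ} (hγ : 0 < γ) {Y : Matrix (Fin n) (Fin n) ℝ}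
    {X : Matrix (Fin n) (Fin m) ℝ} {θ : Matrix (Fin m) (Fin m) ℝ}
    (hf : PerspectiveFeasible Y X θ) (hX : A * X = B) (hXK : X ∈ K)
    {α : Matrix (Fin n) (Fin m) ℝ} {Q : Matrix (Fin l) (Fin m) ℝ}
    (hQ : C - α - A.transpose * Q ∈ dualCone K) :
    frob B Q - γ / 2 * frob α (Y * α) ≤ frob C X + 1 / (2 * γ) * θ.trace := by
  have h1 := hQ X hXK
  rw [frob_sub_left, frob_sub_left, frob_mul_left, Matrix.transpose_transpose, hX,
    frob_comm Q B] at h1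
  -- The scaling by `γ` turns the inequality, divided by `2γ`, into a lower bound for `tr θ / (2γ) +
  -- ⟨α, X⟩`.
  have h2 := hf.trace_nonneg (γ • α)
  have e1 : frob (γ • α) X = γ * frob α X := by simp [frob]
  have e2 : frob (γ • α) (Y * (γ • α)) = γ * (γ * frob α (Y * α)) := by simp [frob]
  rw [e1, e2] at h2
  have h3 : 0 ≤ 1 / (2 * γ) * (θ.trace + 2 * (γ * frob α X) + γ * (γ * frob α (Y * α))) :=
    mul_nonneg (by positivity) h2
  have h4 : 1 / (2 * γ) * (θ.trace + 2 * (γ * frob α X) + γ * (γ * frob α (Y * α))) =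
      1 / (2 * γ) * θ.trace + frob α X + γ / 2 * frob α (Y * α) := by
    field_simp
  linarith

/-- Adding a real number commutes with suprema in `EReal`, empty ones included. The resulting terms
are real and affine in `Y`. -/
theorem saddleValue_eq_iSup (γ lam : ℝ) (Y : Matrix (Fin n) (Fin n) ℝ) :
    saddleValue C A B K γ lam Y =
      ⨆ (α : Matrix (Fin n) (Fin m) ℝ) (Q : Matrix (Fin l) (Fin m) ℝ)
        (_ : C - α - A.transpose * Q ∈ dualCone K),
        ((frob B Q - γ / 2 * frob α (Y * α) + lam * Y.trace : ℝ) : EReal) := by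
  have hreal : ∀ (α : Matrix (Fin n) (Fin m) ℝ) (Q : Matrix (Fin l) (Fin m) ℝ),
      ((frob B Q - γ / 2 * frob α (Y * α) + lam * Y.trace : ℝ) : EReal) =
        (frob B Q : EReal) + ((-(γ / 2 * frob α (Y * α)) + lam * Y.trace : ℝ) : EReal) := by
    intro α Q
    rw [← EReal.coe_add]
    congr 1
    ring
  refine iSup_congr fun α => ?_
  simp only [hreal]
  apply le_antisymm
  · rw [← EReal.le_sub_iff_add_le (.inl (EReal.coe_ne_bot _)) (.inl (EReal.coe_ne_top _))]
    refine iSup₂_le fun Q hQ => ?_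
    rw [EReal.le_sub_iff_add_le (.inl (EReal.coe_ne_bot _)) (.inl (EReal.coe_ne_top _))]
    exact le_iSup₂ (f := fun (Q : Matrix (Fin l) (Fin m) ℝ)
      (_ : C - α - A.transpose * Q ∈ dualCone K) => (frob B Q : EReal) +
        ((-(γ / 2 * frob α (Y * α)) + lam * Y.trace : ℝ) : EReal)) Q hQ
  · refine iSup₂_le fun Q hQ => add_le_add_left ?_ _
    exact le_iSup₂ (f := fun (Q : Matrix (Fin l) (Fin m) ℝ)
      (_ : C - α - A.transpose * Q ∈ dualCone K) => (frob B Q : EReal)) Q hQ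

theorem saddleValue_le_perspectiveObjective {γ : ℝ} (hγ : 0 < γ) (lam : ℝ)
    {Y : Matrix (Fin n) (Fin n) ℝ} {X : Matrix (Fin n) (Fin m) ℝ}
    {θ : Matrix (Fin m) (Fin m) ℝ} (hf : PerspectiveFeasible Y X θ) :
    saddleValue C A B K γ lam Y ≤ perspectiveObjective C A B K γ lam Y X θ := by
  unfold perspectiveObjective g
  split_ifs with hX
  · rw [saddleValue_eq_iSup, ← EReal.coe_add]
    refine iSup_le fun α => iSup₂_le fun Q hQ => EReal.coe_le_coe_iff.2 ?_
    linarith [dual_le_primal hγ hf hX.1 hX.2 hQ]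
  · rw [EReal.top_add_coe]
    exact le_top

/-- The block matrix is the Gram product `M Mᵀ` with `M = (Zᵀ; R)`. -/
theorem perspectiveFeasible_factor (R : Matrix (Fin n) (Fin n) ℝ)
    (Z : Matrix (Fin n) (Fin m) ℝ) :
    PerspectiveFeasible (R * R.transpose) (R * Z) (Z.transpose * Z) := by
  refine ⟨by simp [Matrix.IsSymm], ?_⟩
  have h := Matrix.posSemidef_self_mul_conjTranspose (Matrix.fromRows Z.transpose R)
  rwa [Matrix.conjTranspose_eq_transpose_of_trivial, Matrix.transpose_fromRows,
    Matrix.fromRows_mul_fromCols, Matrix.transpose_transpose, ← Matrix.transpose_mul] at h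

theorem saddleValue_ne_bot (γ lam : ℝ) (Y : Matrix (Fin n) (Fin n) ℝ) :
    saddleValue C A B K γ lam Y ≠ ⊥ := by
  rw [saddleValue_eq_iSup]
  -- The choice `α = C`, `Q = 0` leaves slack `0`, which lies in every dual cone.
  refine ne_bot_of_le_ne_bot (EReal.coe_ne_bot _)
    (le_iSup_of_le C (le_iSup₂_of_le 0 ?_ le_rfl))
  intro X _
  simp [frob]

theorem isLeast_saddleValue (hK : IsProperCone K) {γ : ℝ} (hγ : 0 < γ) (lam : ℝ)
    {Y : Matrix (Fin n) (Fin n) ℝ} (hY : Y.PosSemidef) :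
    IsLeast {v : EReal | ∃ (X : Matrix (Fin n) (Fin m) ℝ) (θ : Matrix (Fin m) (Fin m) ℝ),
        PerspectiveFeasible Y X θ ∧ v = perspectiveObjective C A B K γ lam Y X θ}
      (saddleValue C A B K γ lam Y) := by
  refine ⟨?_, ?_⟩
  swap
  · rintro _ ⟨X, θ, hf, rfl⟩
    exact saddleValue_le_perspectiveObjective hγ lam hf
  obtain ⟨R, rfl⟩ : ∃ R : Matrix (Fin n) (Fin n) ℝ, Y = R * R.transpose := by
    open scoped MatrixOrder in
    obtain ⟨S, hS⟩ := CStarAlgebra.nonneg_iff_eq_star_mul_self.1 hY.nonneg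
    exact ⟨S.transpose, by rw [Matrix.transpose_transpose]; exact hS⟩
  suffices ∃ Z : Matrix (Fin n) (Fin m) ℝ,
      perspectiveObjective C A B K γ lam (R * R.transpose) (R * Z) (Z.transpose * Z) ≤
        saddleValue C A B K γ lam (R * R.transpose) by
    obtain ⟨Z, hZ⟩ := this
    exact ⟨_, _, perspectiveFeasible_factor R Z, le_antisymm
      (saddleValue_le_perspectiveObjective hγ lam (perspectiveFeasible_factor R Z)) hZ⟩
  -- If the dual value is `⊤`, any feasible pair attains it, with `Z = 0` as a witness.
  rcases eq_or_ne (saddleValue C A B K γ lam (R * R.transpose)) ⊤ with htop | htop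
  · exact ⟨0, htop ▸ le_top⟩
  lift saddleValue C A B K γ lam (R * R.transpose) to ℝ
    using ⟨htop, saddleValue_ne_bot γ lam _⟩ with D hD
  obtain ⟨Z, h1, h2, h3⟩ := exists_factor_le_of_dual_le (C := C) (A := A) (B := B) hK hγ R
    (D - lam * (R * R.transpose).trace) (fun α Q hQ => by
      have h : ((frob B Q - γ / 2 * frob α (R * R.transpose * α) +
          lam * (R * R.transpose).trace : ℝ) : EReal) ≤ (D : EReal) := by
        rw [hD, saddleValue_eq_iSup]
        exact le_iSup_of_le α (le_iSup₂_of_le Q hQ le_rfl)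
      linarith [EReal.coe_le_coe_iff.1 h])
  refine ⟨Z, ?_⟩
  rw [perspectiveObjective, g, if_pos ⟨h1, h2⟩, ← EReal.coe_add, EReal.coe_le_coe_iff]
  change frob C (R * Z) + (1 / (2 * γ) * frob Z Z + lam * (R * R.transpose).trace) ≤ D
  linarith

theorem lowerSemicontinuous_saddleValue (γ lam : ℝ) :
    LowerSemicontinuous (saddleValue C A B K γ lam) := by
  have : saddleValue C A B K γ lam = fun Y => _ := funext (saddleValue_eq_iSup γ lam)
  rw [this]
  refine lowerSemicontinuous_iSup fun α => lowerSemicontinuous_iSup fun Q =>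
    lowerSemicontinuous_iSup fun _ => Continuous.lowerSemicontinuous ?_
  refine continuous_coe_real_ereal.comp ?_
  unfold frob
  fun_prop

end duality

/-! ### The feasible set of `Y` and the outer minimization. -/

theorem posSemidef_of_mem_convexHull {n k : ℕ} {Y : Matrix (Fin n) (Fin n) ℝ}
    (hY : Y ∈ convexHull ℝ (projections n k)) : Y.PosSemidef := by
  refine convexHull_min (t := {Y | Y.PosSemidef}) (fun P hP => ?_) ?_ hY
  · have h := Matrix.posSemidef_self_mul_conjTranspose P
    rwa [Matrix.conjTranspose_eq_transpose_of_trivial, hP.1, hP.2.1] at h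
  · intro P hP Q hQ s t hs ht _
    exact (hP.smul hs).add (hQ.smul ht)

theorem isCompact_projections (n k : ℕ) : IsCompact (projections n k) := by
  have hsub : projections n k ⊆
      Set.univ.pi fun _ => Set.univ.pi fun _ => Set.Icc (-((k : ℝ) + 1)) ((k : ℝ) + 1) := by
    rintro P ⟨h1, h2, h3⟩ i - j -
    -- For a projection, `‖P‖² = tr (Pᵀ P) = tr P`.
    have hsum : ∑ j, ∑ i, P i j * P i j ≤ k := by
      rw [← frob_eq_sum, frob, h1, h2]
      exact h3
    have hle : P i j * P i j ≤ k := by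
      refine le_trans ?_ hsum
      refine (Finset.single_le_sum (f := fun i => P i j * P i j)
        (fun i _ => mul_self_nonneg _) (Finset.mem_univ i)).trans ?_
      exact Finset.single_le_sum (f := fun j => ∑ i, P i j * P i j)
        (fun j _ => Finset.sum_nonneg fun i _ => mul_self_nonneg _) (Finset.mem_univ j)
    have hk : (0 : ℝ) ≤ k := k.cast_nonneg
    exact abs_le.1 (abs_le_of_sq_le_sq (by nlinarith) (by positivity))
  refine IsCompact.of_isClosed_subset
    (isCompact_univ_pi fun _ => isCompact_univ_pi fun _ => isCompact_Icc) ?_ hsub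
  have h1 : IsClosed {P : Matrix (Fin n) (Fin n) ℝ | P.transpose = P} :=
    isClosed_eq continuous_id.matrix_transpose continuous_id
  have h2 : IsClosed {P : Matrix (Fin n) (Fin n) ℝ | P * P = P} :=
    isClosed_eq (continuous_id.matrix_mul continuous_id) continuous_id
  have h3 : IsClosed {P : Matrix (Fin n) (Fin n) ℝ | P.trace ≤ (k : ℝ)} :=
    isClosed_le continuous_id.matrix_trace continuous_const
  exact h1.inter (h2.inter h3)

end MixedProjection

theorem lemma5 {n m l : ℕ} (k : ℕ)
    (C : Matrix (Fin n) (Fin m) ℝ) (A : Matrix (Fin l) (Fin n) ℝ)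
    (B : Matrix (Fin l) (Fin m) ℝ) (K : Set (Matrix (Fin n) (Fin m) ℝ))
    (hK : MixedProjection.IsProperCone K)
    (γ lam : ℝ) (hγ : 0 < γ)
    (hSD : MixedProjection.StrongDuality C A B K γ k) :
    (∀ Y ∈ convexHull ℝ (MixedProjection.projections n k),
      IsLeast
        {v : EReal | ∃ (X : Matrix (Fin n) (Fin m) ℝ) (θ : Matrix (Fin m) (Fin m) ℝ),
          MixedProjection.PerspectiveFeasible Y X θ ∧
            v = MixedProjection.perspectiveObjective C A B K γ lam Y X θ}
        (MixedProjection.saddleValue C A B K γ lam Y)) ∧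
    ∃ v : EReal,
      IsLeast
        {v : EReal | ∃ Y ∈ convexHull ℝ (MixedProjection.projections n k),
          v = MixedProjection.saddleValue C A B K γ lam Y} v ∧
      IsLeast
        {v : EReal | ∃ Y ∈ convexHull ℝ (MixedProjection.projections n k),
          ∃ (X : Matrix (Fin n) (Fin m) ℝ) (θ : Matrix (Fin m) (Fin m) ℝ),
            MixedProjection.PerspectiveFeasible Y X θ ∧
              v = MixedProjection.perspectiveObjective C A B K γ lam Y X θ} v := by

  have hleast := fun Y (hY : Y ∈ convexHull ℝ (MixedProjection.projections n k)) =>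
    MixedProjection.isLeast_saddleValue (C := C) (A := A) (B := B) hK hγ lam
      (MixedProjection.posSemidef_of_mem_convexHull hY)
  refine ⟨hleast, ?_⟩
  have hzero : (0 : Matrix (Fin n) (Fin n) ℝ) ∈ convexHull ℝ (MixedProjection.projections n k) :=
    subset_convexHull ℝ _ ⟨by simp [Matrix.IsSymm], by simp, by simp⟩
  obtain ⟨Y, hY, hmin⟩ := LowerSemicontinuousOn.exists_isMinOn ⟨0, hzero⟩
    (MixedProjection.isCompact_projections n k).convexHull_of_finiteDimensional
    ((MixedProjection.lowerSemicontinuous_saddleValue (C := C) (A := A) (B := B) (K := K)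
      γ lam).lowerSemicontinuousOn _)
  refine ⟨MixedProjection.saddleValue C A B K γ lam Y, ⟨⟨Y, hY, rfl⟩, ?_⟩, ?_, ?_⟩
  · rintro _ ⟨Y', hY', rfl⟩
    exact hmin hY'
  · obtain ⟨X, θ, hf, hv⟩ := (hleast Y hY).1
    exact ⟨Y, hY, X, θ, hf, hv⟩
  · rintro _ ⟨Y', hY', X, θ, hf, rfl⟩
    exact (hmin hY').trans ((hleast Y' hY').2 ⟨X, θ, hf, rfl⟩)
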